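/- Let $\eta(\tau)=e^{\pi i\tau/12}\prod_{n\ge1}(1-e^{2\pi i n\tau})$ be the Dedekind eta function on the upper half-plane $\mathbb{H}$. Let $G_8$ be the function on the open unit disc given by $$G_8(q)=q\prod_{n\ge1}\frac{(1-q^{8n})^4(1-q^{2n})^2}{(1-q^{4n})^2(1-q^n)^4},$$ so that $$G_8(e^{2\pi i\tau})=\frac{\eta(8\tau)^4\,\eta(2\tau)^2}{\eta(4\tau)^2\,\eta(\tau)^4}\qquad(\tau\in\mathbb{H}).$$ Then for every complex number $q$ with $|q|<1$, $$G_8(q)^2=\bigl(8G_8(q^2)+32G_8(q^2)^2\bigr)G_8(q)+G_8(q^2)+4G_8(q^2)^2 .$$ Moreover, for every $\tau\in\mathbb{H}$, with $q=e^{2\pi i\tau}$, $$\left(\frac{\eta(4\tau)}{\eta(\tau)}\right)^8=G_8(q)+4G_8(q)^2 .$$ -/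

import Mathlib

open ModularForm

noncomputable section

/-- Euler's product `∏_{n ≥ 1} (1 - q ^ n)`, for a complex number `q` with `‖q‖ < 1`. -/
def eulerProd (q : ℂ) : ℂ := ∏' n : ℕ, (1 - q ^ (n + 1))

/-- The eta-quotient `g₈(τ) = η(8τ)⁴ η(2τ)² / (η(4τ)² η(τ)⁴)` on the upper half-plane. -/
def g8 (τ : ℂ) : ℂ := eta (8 * τ) ^ 4 * eta (2 * τ) ^ 2 / (eta (4 * τ) ^ 2 * eta τ ^ 4)

/-- The function `G₈` on the open unit disc with `G₈(e^{2πiτ}) = g₈(τ)` (see `G8_exp`), that is,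
`G₈(q) = q ∏_{n ≥ 1} (1 - q^{8n})⁴ (1 - q^{2n})² / ((1 - q^{4n})² (1 - q^n)⁴)`. -/
def G8 (q : ℂ) : ℂ :=
  q * (eulerProd (q ^ 8) ^ 4 * eulerProd (q ^ 2) ^ 2) /
    (eulerProd (q ^ 4) ^ 2 * eulerProd q ^ 4)

theorem eta_nat_mul (d : ℕ) (τ : ℂ) :
    eta (d * τ) = Complex.exp (2 * Real.pi * Complex.I * τ / 24) ^ d *
      eulerProd (Complex.exp (2 * Real.pi * Complex.I * τ) ^ d) := by
  have h1 : Complex.exp (2 * Real.pi * Complex.I * (d * τ) / 24)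
      = Complex.exp (2 * Real.pi * Complex.I * τ / 24) ^ d := by
    rw [← Complex.exp_nat_mul]; congr 1; ring
  have h2 : Complex.exp (2 * Real.pi * Complex.I * (d * τ))
      = Complex.exp (2 * Real.pi * Complex.I * τ) ^ d := by
    rw [← Complex.exp_nat_mul]; congr 1; ring
  unfold eta eulerProd
  simp only [eta_q_eq_pow, Function.Periodic.qParam]
  push_cast
  rw [h1, h2]

/-- `G₈(q) = g₈(τ)` for `q = e^{2πiτ}`. -/
theorem G8_exp (τ : UpperHalfPlane) :
    G8 (Complex.exp (2 * Real.pi * Complex.I * τ)) = g8 τ := by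
  have e8 := eta_nat_mul 8 τ
  have e4 := eta_nat_mul 4 τ
  have e2 := eta_nat_mul 2 τ
  have e1 := eta_nat_mul 1 τ
  have hx : Complex.exp (2 * Real.pi * Complex.I * τ) =
      Complex.exp (2 * Real.pi * Complex.I * τ / 24) ^ 24 := by
    rw [← Complex.exp_nat_mul]; congr 1; push_cast; ring
  have hx0 := Complex.exp_ne_zero (2 * Real.pi * Complex.I * τ / 24)
  push_cast at e8 e4 e2 e1
  simp only [one_mul, pow_one] at e1
  unfold g8 G8
  rw [e8, e4, e2, e1]
  set x := Complex.exp (2 * Real.pi * Complex.I * τ / 24)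
  set q := Complex.exp (2 * Real.pi * Complex.I * τ)
  have key : ∀ A B C D : ℂ, (x ^ 8 * A) ^ 4 * (x ^ 2 * B) ^ 2 / ((x ^ 4 * C) ^ 2 * (x * D) ^ 4)
      = x ^ 24 * (A ^ 4 * B ^ 2) / (C ^ 2 * D ^ 4) := by
    intro A B C D
    rw [show (x ^ 8 * A) ^ 4 * (x ^ 2 * B) ^ 2 = x ^ 12 * (x ^ 24 * (A ^ 4 * B ^ 2)) by ring,
      show (x ^ 4 * C) ^ 2 * (x * D) ^ 4 = x ^ 12 * (C ^ 2 * D ^ 4) by ring,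
      mul_div_mul_left _ _ (pow_ne_zero _ hx0)]
  rw [key, ← hx]

end

/-! Write φ(q) = `thetaSeries q 1`. Jacobi's triple product turns theta series into Euler products.
Splitting the lattice sum for φ(q)² by parity gives φ(q)² + φ(-q)² = 2φ(q²)², and it identifies
G₈(q) as (φ(q)² - φ(-q)²)/(8φ(-q)²) (`G8_eq_thetaSeries`). With t = φ(q)/φ(-q) this says 1 + 8G₈(q)
= t². Since also φ(q)φ(-q) = φ(-q²)² (`thetaSeries_mul_neg`), 1 + 8G₈(q²) = (t + 1/t)/2. Eliminating
t gives the quadratic relation. For the eta quotient, 1 + 4G₈(q) = φ(q²)²/φ(-q)² is itself an Euler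
product quotient, and so is G₈(q)(1 + 4G₈(q)). -/

open Filter Topology

/-! ### Gaussian binomials and the finite triple product -/

/-- The Gaussian binomial coefficient with base `p`. -/
def gaussBinom (p : ℂ) : ℕ → ℕ → ℂ
  | _, 0 => 1
  | 0, _ + 1 => 0
  | m + 1, k + 1 => p ^ (k + 1) * gaussBinom p m (k + 1) + gaussBinom p m k

theorem gaussBinom_zero_right (p : ℂ) (m : ℕ) : gaussBinom p m 0 = 1 := by
  cases m <;> rfl

theorem gaussBinom_eq_zero_of_lt (p : ℂ) : ∀ {m k : ℕ}, m < k → gaussBinom p m k = 0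
  | 0, _ + 1, _ => rfl
  | m + 1, k + 1, h => by
    rw [gaussBinom, gaussBinom_eq_zero_of_lt p (by omega : m < k + 1),
      gaussBinom_eq_zero_of_lt p (by omega : m < k)]
    ring

/-- The finite Euler product `∏_{i = 1}^{m} (1 - p ^ i)`. -/
def eulerPartial (p : ℂ) (m : ℕ) : ℂ := ∏ i ∈ Finset.range m, (1 - p ^ (i + 1))

theorem eulerPartial_succ (p : ℂ) (m : ℕ) :
    eulerPartial p (m + 1) = eulerPartial p m * (1 - p ^ (m + 1)) :=
  Finset.prod_range_succ _ _

/-- Division-free factorial formula, valid even at roots of unity. The two Pascal terms combine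
through (1 - p^(a+1)) + p^(a+1)(1 - p^(b+1)) = 1 - p^(a+b+2). -/
theorem gaussBinom_add_mul (p : ℂ) (a b : ℕ) :
    gaussBinom p (a + b) a * (eulerPartial p a * eulerPartial p b) = eulerPartial p (a + b) := by
  induction hs : a + b generalizing a b with
  | zero =>
    obtain ⟨rfl, rfl⟩ : a = 0 ∧ b = 0 := by omega
    simp [gaussBinom, eulerPartial]
  | succ s ih =>
    rcases a with _ | a
    · obtain rfl : b = s + 1 := by omega
      simp [gaussBinom, eulerPartial]
    · rw [gaussBinom]
      have h1 := ih a b (by omega)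
      rcases b with _ | b
      · obtain rfl : a = s := by omega
        rw [gaussBinom_eq_zero_of_lt p (Nat.lt_succ_self _), eulerPartial_succ]
        linear_combination (1 - p ^ (a + 1)) * h1
      · have h2 := ih (a + 1) b (by omega)
        obtain rfl : s = a + b + 1 := by omega
        rw [eulerPartial_succ] at h1 h2
        rw [eulerPartial_succ p a, eulerPartial_succ p b, eulerPartial_succ p (a + b + 1)]
        linear_combination (1 - p ^ (a + 1)) * h1 + p ^ (a + 1) * (1 - p ^ (b + 1)) * h2

/-- The q-binomial theorem: peeling off the factor i = 0 replaces x by xp in the rest, hence the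
induction for all x. -/
theorem prod_one_add_mul_pow (p x : ℂ) (m : ℕ) :
    ∏ i ∈ Finset.range m, (1 + x * p ^ i) =
      ∑ k ∈ Finset.range (m + 1), gaussBinom p m k * p ^ (k.choose 2) * x ^ k := by
  induction m generalizing x with
  | zero => simp [gaussBinom]
  | succ m ih =>
    have h : ∀ i, 1 + x * p ^ (i + 1) = 1 + (x * p) * p ^ i := fun i => by ring
    rw [Finset.prod_range_succ', Finset.sum_range_succ']
    simp only [h, ih]
    have hterm : ∀ k, gaussBinom p (m + 1) (k + 1) * p ^ ((k + 1).choose 2) * x ^ (k + 1) =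
        gaussBinom p m (k + 1) * p ^ ((k + 1).choose 2) * (x * p) ^ (k + 1) +
          x * (gaussBinom p m k * p ^ (k.choose 2) * (x * p) ^ k) := by
      intro k
      rw [gaussBinom, Nat.choose_succ_succ' k 1, Nat.choose_one_right]
      ring
    simp only [hterm, Finset.sum_add_distrib, ← Finset.mul_sum]
    have h2 := Finset.sum_range_succ'
      (fun k => gaussBinom p m k * p ^ (k.choose 2) * (x * p) ^ k) (m + 1)
    rw [Finset.sum_range_succ, gaussBinom_eq_zero_of_lt p (Nat.lt_succ_self m)] at h2
    simp only [gaussBinom_zero_right, Nat.choose_zero_succ, pow_zero] at h2 ⊢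
    linear_combination h2

theorem choose_two_cast (k : ℕ) : 2 * ((k.choose 2 : ℕ) : ℤ) = (k : ℤ) ^ 2 - k := by
  induction k with
  | zero => simp
  | succ k ih =>
    rw [Nat.choose_succ_succ' k 1, Nat.choose_one_right]
    push_cast
    linarith

/-- The shift q^(1-2n) makes the exponents run over the odd numbers from 1-2n to 2n-1. The negative
half is flipped by 1 + w = w(1 + w⁻¹), which produces the prefactor. -/
theorem prod_one_add_mul_one_add_inv {q z : ℂ} (hq : q ≠ 0) (hz : z ≠ 0) (n : ℕ) :
    ∏ i ∈ Finset.range (2 * n), (1 + z * q ^ (1 - 2 * n : ℤ) * (q ^ 2) ^ i) =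
      z ^ n * q ^ (-(n : ℤ) ^ 2) * ((∏ i ∈ Finset.range n, (1 + z * q ^ (2 * i + 1))) *
        ∏ i ∈ Finset.range n, (1 + z⁻¹ * q ^ (2 * i + 1))) := by
  have hpow : ∀ (a : ℤ) (k : ℕ), q ^ a * q ^ k = q ^ (a + k) := fun a k => by
    rw [zpow_add₀ hq, zpow_natCast]
  have hneg : ∏ i ∈ Finset.range n, (1 + z * q ^ (1 - 2 * n : ℤ) * (q ^ 2) ^ i) =
      z ^ n * q ^ (-(n : ℤ) ^ 2) * ∏ i ∈ Finset.range n, (1 + z⁻¹ * q ^ (2 * i + 1)) := by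
    rw [← Finset.prod_range_reflect]
    have hterm : ∀ i ∈ Finset.range n,
        1 + z * q ^ (1 - 2 * n : ℤ) * (q ^ 2) ^ (n - 1 - i) =
          (z * q ^ (-(2 * i + 1) : ℤ)) * (1 + z⁻¹ * q ^ (2 * i + 1)) := by
      intro i hi
      have hi := Finset.mem_range.1 hi
      rw [← pow_mul, mul_assoc z, hpow, mul_add, mul_one, add_comm,
        show z * q ^ (-(2 * i + 1) : ℤ) * (z⁻¹ * q ^ (2 * i + 1)) =
          (z * z⁻¹) * (q ^ (-(2 * i + 1) : ℤ) * q ^ (2 * i + 1)) by ring, hpow,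
        mul_inv_cancel₀ hz]
      have e1 : (1 - 2 * n : ℤ) + ((2 * (n - 1 - i) : ℕ) : ℤ) = -(2 * i + 1) := by
        push_cast [show i ≤ n - 1 by omega, show 1 ≤ n by omega]
        omega
      rw [e1]
      simp
    rw [Finset.prod_congr rfl hterm, Finset.prod_mul_distrib, Finset.prod_mul_distrib,
      Finset.prod_const, Finset.card_range]
    congr 2
    clear hterm
    induction n with
    | zero => simp
    | succ n ih =>
      rw [Finset.prod_range_succ, ih, ← zpow_add₀ hq]
      congr 1
      push_cast
      ring
  rw [two_mul, Finset.prod_range_add, hneg]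
  have hpos : ∀ i, 1 + z * q ^ (1 - 2 * n : ℤ) * (q ^ 2) ^ (n + i) = 1 + z * q ^ (2 * i + 1) := by
    intro i
    rw [← pow_mul, mul_assoc z, hpow, ← zpow_natCast]
    congr 3
    push_cast
    ring
  simp only [hpos]
  ring

/-- The finite form of the Jacobi triple product identity. -/
theorem finite_triple_product {q z : ℂ} (hq : q ≠ 0) (hz : z ≠ 0) (n : ℕ) :
    ∑ j ∈ Finset.Icc (-n : ℤ) n, gaussBinom (q ^ 2) (2 * n) (n + j).toNat * (q ^ (j ^ 2) * z ^ j) =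
      (∏ i ∈ Finset.range n, (1 + z * q ^ (2 * i + 1))) *
        ∏ i ∈ Finset.range n, (1 + z⁻¹ * q ^ (2 * i + 1)) := by
  have hne : z ^ n * q ^ (-(n : ℤ) ^ 2) ≠ 0 := by positivity
  apply mul_left_cancel₀ hne
  rw [← prod_one_add_mul_one_add_inv hq hz, prod_one_add_mul_pow, Finset.mul_sum]
  refine Finset.sum_nbij' (fun j => (n + j).toNat) (fun k => (k : ℤ) - n) ?_ ?_ ?_ ?_ ?_
  · intro j hj
    simp only [Finset.mem_Icc, Finset.mem_range] at hj ⊢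
    omega
  · intro k hk
    simp only [Finset.mem_Icc, Finset.mem_range] at hk ⊢
    omega
  · intro j hj
    simp only [Finset.mem_Icc] at hj ⊢
    omega
  · intro k hk
    simp
  · intro j hj
    simp only [Finset.mem_Icc] at hj
    obtain ⟨k, hk⟩ : ∃ k : ℕ, (n + j).toNat = k := ⟨_, rfl⟩
    obtain rfl : j = k - n := by omega
    have hA : (q ^ 2) ^ k.choose 2 = q ^ ((2 * k.choose 2 : ℕ) : ℤ) := by
      rw [zpow_natCast, pow_mul]
    have hB : (q ^ (1 - 2 * n : ℤ)) ^ k = q ^ ((1 - 2 * n : ℤ) * k) := by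
      rw [zpow_mul, zpow_natCast]
    have hC : z ^ (k - n : ℤ) = z ^ k / z ^ n := by
      rw [zpow_sub₀ hz, zpow_natCast, zpow_natCast]
    rw [hk, mul_pow, hA, hB, hC]
    have hc := choose_two_cast k
    have e : ((2 * k.choose 2 : ℕ) : ℤ) + (1 - 2 * n) * k = -(n : ℤ) ^ 2 + (k - n : ℤ) ^ 2 := by
      push_cast
      linear_combination hc
    have e2 := congrArg (q ^ ·) e
    simp only [zpow_add₀ hq] at e2
    have hzn : z ^ n * (z ^ k / z ^ n) = z ^ k := by field_simp
    linear_combination (-gaussBinom (q ^ 2) (2 * n) k * z ^ k) * e2 +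
      gaussBinom (q ^ 2) (2 * n) k * q ^ (-(n : ℤ) ^ 2) * q ^ ((k - n : ℤ) ^ 2) * hzn

/-! ### Passage to the limit: the Jacobi triple product -/

theorem pow_succ_norm_lt_one {q : ℂ} (hq : ‖q‖ < 1) (n : ℕ) : ‖q ^ (n + 1)‖ < 1 := by
  rw [norm_pow]
  exact pow_lt_one₀ (norm_nonneg _) hq n.succ_ne_zero

theorem one_sub_pow_succ_ne_zero {q : ℂ} (hq : ‖q‖ < 1) (n : ℕ) : 1 - q ^ (n + 1) ≠ 0 := by
  intro h
  have := pow_succ_norm_lt_one hq n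
  rw [← sub_eq_zero.1 h] at this
  simp at this

theorem eulerProd_ne_zero {q : ℂ} (hq : ‖q‖ < 1) : eulerProd q ≠ 0 := by
  have h := tprod_one_add_ne_zero_of_summable (f := fun n : ℕ => -q ^ (n + 1))
    (fun n => by simpa [sub_eq_add_neg] using one_sub_pow_succ_ne_zero hq n)
    (by simpa using (summable_nat_add_iff 1).2 (summable_geometric_of_lt_one (norm_nonneg _) hq))
  simpa [eulerProd, sub_eq_add_neg] using h

theorem eulerPartial_ne_zero {q : ℂ} (hq : ‖q‖ < 1) (m : ℕ) : eulerPartial q m ≠ 0 :=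
  Finset.prod_ne_zero_iff.2 fun i _ => one_sub_pow_succ_ne_zero hq i

theorem tendsto_eulerPartial {q : ℂ} (hq : ‖q‖ < 1) :
    Tendsto (eulerPartial q) atTop (𝓝 (eulerProd q)) :=
  (multipliable_one_sub_pow hq).tendsto_prod_tprod_nat

theorem gaussBinom_eq_div {p : ℂ} (hp : ‖p‖ < 1) (a b : ℕ) :
    gaussBinom p (a + b) a =
      eulerPartial p (a + b) * ((eulerPartial p a)⁻¹ * (eulerPartial p b)⁻¹) := by
  rw [← gaussBinom_add_mul p a b]
  have := eulerPartial_ne_zero hp a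
  have := eulerPartial_ne_zero hp b
  field_simp

/-- Supplies the uniform majorant for dominated convergence: the partial Euler products and their
inverses both converge, so both are bounded. -/
theorem exists_norm_gaussBinom_le {p : ℂ} (hp : ‖p‖ < 1) :
    ∃ C : ℝ, ∀ m k, ‖gaussBinom p m k‖ ≤ C := by
  obtain ⟨A, hA⟩ := (Metric.isBounded_range_of_tendsto _ (tendsto_eulerPartial hp)).exists_norm_le
  obtain ⟨B, hB⟩ := (Metric.isBounded_range_of_tendsto _
    ((tendsto_eulerPartial hp).inv₀ (eulerProd_ne_zero hp))).exists_norm_le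
  have hA' : ∀ m, ‖eulerPartial p m‖ ≤ A := fun m => hA _ ⟨m, rfl⟩
  have hB' : ∀ m, ‖(eulerPartial p m)⁻¹‖ ≤ B := fun m => hB _ ⟨m, rfl⟩
  have hA0 : 0 ≤ A := (norm_nonneg _).trans (hA' 0)
  have hB0 : 0 ≤ B := (norm_nonneg _).trans (hB' 0)
  refine ⟨A * (B * B), fun m k => ?_⟩
  rcases lt_or_ge m k with h | h
  · rw [gaussBinom_eq_zero_of_lt p h, norm_zero]
    positivity
  · obtain ⟨b, rfl⟩ := Nat.exists_eq_add_of_le h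
    rw [gaussBinom_eq_div hp, norm_mul, norm_mul]
    gcongr
    exacts [hA' _, hB' _, hB' _]

theorem tendsto_gaussBinom_central {p : ℂ} (hp : ‖p‖ < 1) (j : ℤ) :
    Tendsto (fun n : ℕ => gaussBinom p (2 * n) (n + j).toNat) atTop (𝓝 (eulerProd p)⁻¹) := by
  have hE := eulerProd_ne_zero hp
  have h := tendsto_eulerPartial hp
  have h1 : Tendsto (fun n : ℕ => (n + j).toNat) atTop atTop :=
    tendsto_atTop.2 fun b => by
      filter_upwards [eventually_ge_atTop (b + j.natAbs)] with n hn
      omega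
  have h2 : Tendsto (fun n : ℕ => (n - j).toNat) atTop atTop :=
    tendsto_atTop.2 fun b => by
      filter_upwards [eventually_ge_atTop (b + j.natAbs)] with n hn
      omega
  have h3 : Tendsto (fun n : ℕ => 2 * n) atTop atTop :=
    tendsto_atTop.2 fun b => by
      filter_upwards [eventually_ge_atTop b] with n hn
      omega
  have hlim := (h.comp h3).mul
    (((h.comp h1).inv₀ hE).mul ((h.comp h2).inv₀ hE))
  rw [mul_inv_cancel_left₀ hE] at hlim
  refine hlim.congr' ?_
  filter_upwards [eventually_ge_atTop j.natAbs] with n hn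
  have e : 2 * n = (n + j).toNat + (n - j).toNat := by omega
  simp only [Function.comp_apply]
  rw [e, gaussBinom_eq_div hp]

/-- With q = exp(πiτ) and z = exp(2πiw) these are the terms of `jacobiTheta₂`, and ‖q‖ < 1 means Im
τ > 0. -/
theorem summable_theta {q z : ℂ} (hq0 : q ≠ 0) (hq : ‖q‖ < 1) (hz : z ≠ 0) :
    Summable fun j : ℤ => q ^ (j ^ 2) * z ^ j := by
  have hpi : (Real.pi : ℂ) ≠ 0 := by exact_mod_cast Real.pi_ne_zero
  have hI := Complex.I_ne_zero
  set τ : ℂ := Complex.log q / (Real.pi * Complex.I) with hτ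
  set w : ℂ := Complex.log z / (2 * Real.pi * Complex.I) with hw
  have hτ' : Real.pi * Complex.I * τ = Complex.log q := by rw [hτ]; field_simp
  have hw' : 2 * Real.pi * Complex.I * w = Complex.log z := by rw [hw]; field_simp
  have him : 0 < τ.im := by
    have h1 : (Complex.log q).re < 0 := by
      rw [Complex.log_re]
      exact Real.log_neg (norm_pos_iff.2 hq0) hq
    rw [← hτ'] at h1
    simp at h1
    nlinarith [Real.pi_pos]
  refine ((summable_jacobiTheta₂_term_iff w τ).2 him).congr fun j => ?_
  rw [jacobiTheta₂_term, show 2 * Real.pi * Complex.I * j * w + Real.pi * Complex.I * j ^ 2 * τ =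
    ((j ^ 2 : ℤ) : ℂ) * (Real.pi * Complex.I * τ) + (j : ℂ) * (2 * Real.pi * Complex.I * w) by
      push_cast; ring, hτ', hw', Complex.exp_add, Complex.exp_int_mul, Complex.exp_int_mul,
    Complex.exp_log hq0, Complex.exp_log hz]

/-- The theta series `∑ q ^ (j ^ 2) * z ^ j` over all integers `j`. -/
noncomputable def thetaSeries (q z : ℂ) : ℂ := ∑' j : ℤ, q ^ (j ^ 2) * z ^ j

theorem multipliable_one_add_mul_pow {q : ℂ} (hq : ‖q‖ < 1) (z : ℂ) :
    Multipliable fun n : ℕ => 1 + z * q ^ (2 * n + 1) := by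
  apply multipliable_one_add_of_summable
  have h : Summable fun n : ℕ => ‖z‖ * ‖q‖ ^ (2 * n + 1) :=
    ((summable_geometric_of_lt_one (norm_nonneg _) hq).comp_injective
      (i := fun n : ℕ => 2 * n + 1) fun a b h => by simpa using h).mul_left _
  simpa using h

/-- The Jacobi triple product identity. -/
theorem jacobi_triple_product {q z : ℂ} (hq0 : q ≠ 0) (hq : ‖q‖ < 1) (hz : z ≠ 0) :
    thetaSeries q z = eulerProd (q ^ 2) *
      ((∏' n : ℕ, (1 + z * q ^ (2 * n + 1))) * ∏' n : ℕ, (1 + z⁻¹ * q ^ (2 * n + 1))) := by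
  have hp : ‖q ^ 2‖ < 1 := pow_succ_norm_lt_one hq 1
  obtain ⟨C, hC⟩ := exists_norm_gaussBinom_le hp
  have hC0 : 0 ≤ C := (norm_nonneg _).trans (hC 0 0)
  have hlim := tendsto_tsum_of_dominated_convergence (𝓕 := atTop)
    (f := fun (n : ℕ) (j : ℤ) => (Set.Icc (-n : ℤ) n).indicator
      (fun j => gaussBinom (q ^ 2) (2 * n) (n + j).toNat * (q ^ (j ^ 2) * z ^ j)) j)
    (g := fun j => (eulerProd (q ^ 2))⁻¹ * (q ^ (j ^ 2) * z ^ j))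
    ((summable_theta hq0 hq hz).norm.mul_left C)
    (fun j => by
      refine ((tendsto_gaussBinom_central hp j).mul_const _).congr' ?_
      filter_upwards [eventually_ge_atTop j.natAbs] with n hn
      rw [Set.indicator_of_mem]
      simp only [Set.mem_Icc]
      omega)
    (Eventually.of_forall fun n j => by
      refine (norm_indicator_le_norm_self _ _).trans ?_
      rw [norm_mul]
      gcongr
      exact hC _ _)
  have hfin : ∀ n : ℕ, ∑' j : ℤ, (Set.Icc (-n : ℤ) n).indicator
      (fun j => gaussBinom (q ^ 2) (2 * n) (n + j).toNat * (q ^ (j ^ 2) * z ^ j)) j =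
      (∏ i ∈ Finset.range n, (1 + z * q ^ (2 * i + 1))) *
        ∏ i ∈ Finset.range n, (1 + z⁻¹ * q ^ (2 * i + 1)) := by
    intro n
    rw [← finite_triple_product hq0 hz, ← Finset.coe_Icc, ← tsum_subtype]
    exact Finset.tsum_subtype' _
      fun j : ℤ => gaussBinom (q ^ 2) (2 * n) (n + j).toNat * (q ^ (j ^ 2) * z ^ j)
  simp only [hfin, tsum_mul_left] at hlim
  have h := tendsto_nhds_unique hlim
    ((multipliable_one_add_mul_pow hq z).tendsto_prod_tprod_nat.mul
      (multipliable_one_add_mul_pow hq z⁻¹).tendsto_prod_tprod_nat)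
  rw [← h, mul_inv_cancel_left₀ (eulerProd_ne_zero hp), thetaSeries]

/-! ### Theta values as Euler products -/

theorem eulerProd_sq_mul_tprod_odd {q : ℂ} (hq : ‖q‖ < 1) :
    eulerProd (q ^ 2) * ∏' n : ℕ, (1 - q ^ (2 * n + 1)) = eulerProd q := by
  have ho : Multipliable fun n : ℕ => 1 - q ^ (2 * n + 1) := by
    simpa [sub_eq_add_neg] using multipliable_one_add_mul_pow hq (-1)
  have he : Multipliable fun n : ℕ => 1 - q ^ (2 * n + 1 + 1) := by
    refine (multipliable_one_sub_pow (pow_succ_norm_lt_one hq 1)).congr fun n => ?_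
    ring
  rw [eulerProd, eulerProd, mul_comm, ← tprod_even_mul_odd (f := fun n => 1 - q ^ (n + 1)) ho he]
  congr 1
  exact tprod_congr fun n => by ring

theorem multipliable_one_add_pow {q : ℂ} (hq : ‖q‖ < 1) :
    Multipliable fun n : ℕ => 1 + q ^ (n + 1) := by
  apply multipliable_one_add_of_summable
  simpa using (summable_nat_add_iff 1).2 (summable_geometric_of_lt_one (norm_nonneg _) hq)

theorem eulerProd_mul_tprod_one_add {q : ℂ} (hq : ‖q‖ < 1) :
    eulerProd q * ∏' n : ℕ, (1 + q ^ (n + 1)) = eulerProd (q ^ 2) := by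
  rw [eulerProd, ← (multipliable_one_sub_pow hq).tprod_mul (multipliable_one_add_pow hq)]
  exact tprod_congr fun n => by ring

theorem thetaSeries_neg_one_mul {q : ℂ} (hq0 : q ≠ 0) (hq : ‖q‖ < 1) :
    thetaSeries (-q) 1 * eulerProd (q ^ 2) = eulerProd q ^ 2 := by
  rw [jacobi_triple_product (neg_ne_zero.2 hq0) (by simpa using hq) one_ne_zero,
    ← eulerProd_sq_mul_tprod_odd hq]
  have h : ∀ n : ℕ, 1 + 1 * (-q) ^ (2 * n + 1) = 1 - q ^ (2 * n + 1) := fun n => by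
    rw [Odd.neg_pow ⟨n, rfl⟩]; ring
  simp only [inv_one, h, even_two.neg_pow]
  ring

theorem thetaSeries_self_mul {q : ℂ} (hq0 : q ≠ 0) (hq : ‖q‖ < 1) :
    thetaSeries q q * eulerProd (q ^ 2) = 2 * eulerProd (q ^ 4) ^ 2 := by
  have hp : ‖q ^ 2‖ < 1 := pow_succ_norm_lt_one hq 1
  have h1 : ∀ n : ℕ, 1 + q * q ^ (2 * n + 1) = 1 + (q ^ 2) ^ (n + 1) := fun n => by ring
  have h2 : ∀ n : ℕ, 1 + q⁻¹ * q ^ (2 * n + 1) = 1 + (q ^ 2) ^ n := fun n => by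
    rw [pow_succ, pow_mul]; field_simp
  -- At z = q the inverse product starts with 1 + 1, the source of the factor 2.
  have h3 : ∏' n : ℕ, (1 + (q ^ 2) ^ n) = 2 * ∏' n : ℕ, (1 + (q ^ 2) ^ (n + 1)) := by
    have h4 := multipliable_one_add_pow hp
    have h5 := tprod_eq_zero_mul' (f := fun n : ℕ => 1 + (q ^ 2) ^ n) h4
    rw [h5, pow_zero, one_add_one_eq_two]
  rw [jacobi_triple_product hq0 hq hq0, show q ^ 4 = (q ^ 2) ^ 2 by ring,
    ← eulerProd_mul_tprod_one_add hp]
  simp only [h1, h2, h3]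
  ring

/-! ### Quadratic identities between theta values -/

/-- Splitting a lattice sum over `ℤ × ℤ` by the parity of the sum of the coordinates. -/
theorem hasSum_int_prod_of_parity {f : ℤ × ℤ → ℂ} {a b : ℂ}
    (he : HasSum (fun p : ℤ × ℤ => f (p.1 + p.2, p.1 - p.2)) a)
    (ho : HasSum (fun p : ℤ × ℤ => f (p.1 + p.2 + 1, p.1 - p.2)) b) : HasSum f (a + b) := by
  let e : ℤ × ℤ → ℤ × ℤ := fun p => (p.1 + p.2, p.1 - p.2)
  let o : ℤ × ℤ → ℤ × ℤ := fun p => (p.1 + p.2 + 1, p.1 - p.2)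
  have hei : Function.Injective e := fun p r h => by
    simp only [e, Prod.mk.injEq] at h
    ext <;> omega
  have hoi : Function.Injective o := fun p r h => by
    simp only [o, Prod.mk.injEq] at h
    ext <;> omega
  have hd : Disjoint (Set.range e) (Set.range o) := by
    rw [Set.disjoint_left]
    rintro _ ⟨p, rfl⟩ ⟨r, h⟩
    simp only [e, o, Prod.mk.injEq] at h
    omega
  have hu : Set.range e ∪ Set.range o = Set.univ := by
    refine Set.eq_univ_of_forall fun ⟨x, y⟩ => ?_
    rcases Int.even_or_odd (x + y) with ⟨k, hk⟩ | ⟨k, hk⟩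
    · exact Or.inl ⟨(k, x - k), by simp only [e, Prod.mk.injEq]; omega⟩
    · exact Or.inr ⟨(k, x - k - 1), by simp only [o, Prod.mk.injEq]; omega⟩
  have h := (hei.hasSum_range_iff (f := f).2 he).add_disjoint hd
    (hoi.hasSum_range_iff (f := f).2 ho)
  rw [hu, hasSum_subtype_iff_indicator, Set.indicator_univ] at h
  exact h

theorem hasSum_mul_self_of_summable {f : ℤ → ℂ} (hf : Summable f) :
    HasSum (fun p : ℤ × ℤ => f p.1 * f p.2) ((∑' j, f j) ^ 2) := by
  rw [pow_two]
  exact hf.hasSum.mul hf.hasSum (summable_mul_of_summable_norm hf.norm hf.norm)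

theorem hasSum_thetaSeries_sq {q z : ℂ} (hq0 : q ≠ 0) (hq : ‖q‖ < 1) (hz : z ≠ 0) :
    HasSum (fun p : ℤ × ℤ => (q ^ (p.1 ^ 2) * z ^ p.1) * (q ^ (p.2 ^ 2) * z ^ p.2))
      (thetaSeries q z ^ 2) := by
  have h := hasSum_mul_self_of_summable (summable_theta hq0 hq hz)
  simpa only [thetaSeries] using h

/-- From (m+n)² + (m-n)² = 2m² + 2n² and (m+n+1)² + (m-n)² = 1 + 2(m²+m) + 2(n²+n). -/
theorem thetaSeries_one_sq {q : ℂ} (hq0 : q ≠ 0) (hq : ‖q‖ < 1) :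
    thetaSeries q 1 ^ 2 = thetaSeries (q ^ 2) 1 ^ 2 + q * thetaSeries (q ^ 2) (q ^ 2) ^ 2 := by
  have hp : ‖q ^ 2‖ < 1 := pow_succ_norm_lt_one hq 1
  have hp0 : q ^ 2 ≠ 0 := pow_ne_zero _ hq0
  have hq2 : ∀ a : ℤ, (q ^ 2) ^ a = q ^ (2 * a) := fun a => by rw [zpow_mul]; rfl
  refine (hasSum_thetaSeries_sq hq0 hq one_ne_zero).unique (hasSum_int_prod_of_parity ?_ ?_)
  · refine (hasSum_thetaSeries_sq hp0 hp one_ne_zero).congr_fun fun p => ?_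
    simp only [one_zpow, mul_one, hq2, ← zpow_add₀ hq0]
    congr 1
    ring
  · refine ((hasSum_thetaSeries_sq hp0 hp hp0).mul_left q).congr_fun fun p => ?_
    simp only [one_zpow, mul_one, hq2, ← zpow_add₀ hq0, ← zpow_one_add₀ hq0]
    congr 1
    ring

theorem thetaSeries_one_mul {q : ℂ} (hq0 : q ≠ 0) (hq : ‖q‖ < 1) :
    thetaSeries q 1 * (eulerProd (q ^ 4) ^ 2 * eulerProd q ^ 2) = eulerProd (q ^ 2) ^ 5 := by
  have hp : ‖q ^ 2‖ < 1 := pow_succ_norm_lt_one hq 1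
  have h1 := eulerProd_sq_mul_tprod_odd hq
  have h2 := eulerProd_sq_mul_tprod_odd hp
  have hE := eulerProd_ne_zero hp
  have hprod : (∏' n : ℕ, (1 + q ^ (2 * n + 1))) * ∏' n : ℕ, (1 - q ^ (2 * n + 1)) =
      ∏' n : ℕ, (1 - (q ^ 2) ^ (2 * n + 1)) := by
    rw [← Multipliable.tprod_mul (by simpa using multipliable_one_add_mul_pow hq 1)
      (by simpa [sub_eq_add_neg] using multipliable_one_add_mul_pow hq (-1))]
    exact tprod_congr fun n => by ring
  rw [← hprod, show (q ^ 2) ^ 2 = q ^ 4 by ring] at h2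
  rw [jacobi_triple_product hq0 hq one_ne_zero]
  simp only [inv_one, one_mul]
  rw [← h1]
  linear_combination eulerProd (q ^ 2) ^ 3 * (eulerProd (q ^ 4) *
    ((∏' n : ℕ, (1 + q ^ (2 * n + 1))) * ∏' n : ℕ, (1 - q ^ (2 * n + 1))) + eulerProd (q ^ 2)) * h2

theorem thetaSeries_neg_one_sq {q : ℂ} (hq0 : q ≠ 0) (hq : ‖q‖ < 1) :
    thetaSeries (-q) 1 ^ 2 = thetaSeries (q ^ 2) 1 ^ 2 - q * thetaSeries (q ^ 2) (q ^ 2) ^ 2 := by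
  rw [thetaSeries_one_sq (neg_ne_zero.2 hq0) (by simpa using hq), even_two.neg_pow]
  ring

theorem thetaSeries_neg_ne_zero {q : ℂ} (hq0 : q ≠ 0) (hq : ‖q‖ < 1) : thetaSeries (-q) 1 ≠ 0 :=
  fun h => by
    have := thetaSeries_neg_one_mul hq0 hq
    rw [h, zero_mul] at this
    exact pow_ne_zero 2 (eulerProd_ne_zero hq) this.symm

/-- Both sides equal E(q²)⁴/E(q⁴)², where E is `eulerProd`. -/
theorem thetaSeries_mul_neg {q : ℂ} (hq0 : q ≠ 0) (hq : ‖q‖ < 1) :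
    thetaSeries q 1 * thetaSeries (-q) 1 = thetaSeries (-q ^ 2) 1 ^ 2 := by
  have hE1 := eulerProd_ne_zero hq
  have hE2 := eulerProd_ne_zero (pow_succ_norm_lt_one hq 1)
  have hE4 := eulerProd_ne_zero (pow_succ_norm_lt_one hq 3)
  norm_num at hE2 hE4
  have h1 := eq_div_of_mul_eq (by positivity) (thetaSeries_one_mul hq0 hq)
  have h2 := eq_div_of_mul_eq hE2 (thetaSeries_neg_one_mul hq0 hq)
  have h3 := thetaSeries_neg_one_mul (pow_ne_zero 2 hq0) (pow_succ_norm_lt_one hq 1)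
  rw [show (q ^ 2) ^ 2 = q ^ 4 by ring] at h3
  rw [h1, h2, eq_div_of_mul_eq hE4 h3]
  field_simp

/-! ### The function G₈ through theta values -/

theorem G8_eq_thetaSeries {q : ℂ} (hq0 : q ≠ 0) (hq : ‖q‖ < 1) :
    G8 q = (thetaSeries q 1 ^ 2 - thetaSeries (-q) 1 ^ 2) / (8 * thetaSeries (-q) 1 ^ 2) := by
  have hE1 := eulerProd_ne_zero hq
  have hE2 := eulerProd_ne_zero (pow_succ_norm_lt_one hq 1)
  have hE4 := eulerProd_ne_zero (pow_succ_norm_lt_one hq 3)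
  norm_num at hE2 hE4
  have h2 := eq_div_of_mul_eq hE2 (thetaSeries_neg_one_mul hq0 hq)
  have h3 := thetaSeries_self_mul (pow_ne_zero 2 hq0) (pow_succ_norm_lt_one hq 1)
  rw [← pow_mul, ← pow_mul] at h3
  have hnum : thetaSeries q 1 ^ 2 - thetaSeries (-q) 1 ^ 2 =
      2 * q * thetaSeries (q ^ 2) (q ^ 2) ^ 2 := by
    rw [thetaSeries_one_sq hq0 hq, thetaSeries_neg_one_sq hq0 hq]
    ring
  rw [hnum, h2, eq_div_of_mul_eq hE4 h3, G8]
  field_simp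
  norm_num

theorem G8_sq_eq {q : ℂ} (hq : ‖q‖ < 1) :
    G8 q ^ 2 = (8 * G8 (q ^ 2) + 32 * G8 (q ^ 2) ^ 2) * G8 q
      + (G8 (q ^ 2) + 4 * G8 (q ^ 2) ^ 2) := by
  rcases eq_or_ne q 0 with rfl | hq0
  · simp [G8]
  have hp : ‖q ^ 2‖ < 1 := pow_succ_norm_lt_one hq 1
  have hp0 : q ^ 2 ≠ 0 := pow_ne_zero _ hq0
  have hb := thetaSeries_neg_ne_zero hq0 hq
  have hd := thetaSeries_neg_ne_zero hp0 hp
  have hab := thetaSeries_mul_neg hq0 hq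
  -- Needed because φ(-q²)² = φ(q)φ(-q) becomes the denominator of G₈(q²).
  have ha : thetaSeries q 1 ≠ 0 := left_ne_zero_of_mul (hab ▸ pow_ne_zero 2 hd)
  have hc : thetaSeries (q ^ 2) 1 ^ 2 = (thetaSeries q 1 ^ 2 + thetaSeries (-q) 1 ^ 2) / 2 := by
    rw [thetaSeries_one_sq hq0 hq, thetaSeries_neg_one_sq hq0 hq]
    ring
  rw [G8_eq_thetaSeries hp0 hp, G8_eq_thetaSeries hq0 hq, ← hab, hc]
  field_simp
  ring

theorem G8_add_four_mul_sq {q : ℂ} (hq0 : q ≠ 0) (hq : ‖q‖ < 1) :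
    G8 q + 4 * G8 q ^ 2 = q * eulerProd (q ^ 4) ^ 8 / eulerProd q ^ 8 := by
  have hE1 := eulerProd_ne_zero hq
  have hE2 := eulerProd_ne_zero (pow_succ_norm_lt_one hq 1)
  have hE4 := eulerProd_ne_zero (pow_succ_norm_lt_one hq 3)
  have hE8 := eulerProd_ne_zero (pow_succ_norm_lt_one hq 7)
  norm_num at hE2 hE4 hE8
  have hb := thetaSeries_neg_ne_zero hq0 hq
  have h2 := eq_div_of_mul_eq hE2 (thetaSeries_neg_one_mul hq0 hq)
  have h3 := thetaSeries_one_mul (pow_ne_zero 2 hq0) (pow_succ_norm_lt_one hq 1)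
  rw [← pow_mul, ← pow_mul] at h3
  norm_num at h3
  have hfac : 1 + 4 * G8 q = thetaSeries (q ^ 2) 1 ^ 2 / thetaSeries (-q) 1 ^ 2 := by
    have hc : thetaSeries (q ^ 2) 1 ^ 2 = (thetaSeries q 1 ^ 2 + thetaSeries (-q) 1 ^ 2) / 2 := by
      rw [thetaSeries_one_sq hq0 hq, thetaSeries_neg_one_sq hq0 hq]
      ring
    rw [G8_eq_thetaSeries hq0 hq, hc]
    field_simp
    ring
  rw [show G8 q + 4 * G8 q ^ 2 = G8 q * (1 + 4 * G8 q) by ring, hfac, h2,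
    eq_div_of_mul_eq (by positivity) h3, G8]
  field_simp

theorem eta_four_mul_div_eta_pow (τ : UpperHalfPlane) :
    (eta (4 * (τ : ℂ)) / eta (τ : ℂ)) ^ 8 =
      Complex.exp (2 * Real.pi * Complex.I * τ) *
        eulerProd (Complex.exp (2 * Real.pi * Complex.I * τ) ^ 4) ^ 8 /
          eulerProd (Complex.exp (2 * Real.pi * Complex.I * τ)) ^ 8 := by
  have e4 := eta_nat_mul 4 τ
  have e1 := eta_nat_mul 1 τ
  have hx : Complex.exp (2 * Real.pi * Complex.I * τ) =
      Complex.exp (2 * Real.pi * Complex.I * τ / 24) ^ 24 := by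
    rw [← Complex.exp_nat_mul]; congr 1; push_cast; ring
  have hx0 := Complex.exp_ne_zero (2 * Real.pi * Complex.I * τ / 24)
  have hE := eulerProd_ne_zero (UpperHalfPlane.norm_exp_two_pi_I_lt_one τ)
  push_cast at e4 e1
  simp only [one_mul, pow_one] at e1
  rw [e4, e1]
  set x := Complex.exp (2 * Real.pi * Complex.I * τ / 24)
  set q := Complex.exp (2 * Real.pi * Complex.I * τ)
  have key : ∀ A D : ℂ, D ≠ 0 → (x ^ 4 * A / (x * D)) ^ 8 = x ^ 24 * A ^ 8 / D ^ 8 := by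
    intro A D hD
    field_simp
  rw [key _ _ hE, ← hx]

theorem mainTheorem6 :
    (∀ q : ℂ, ‖q‖ < 1 →
      G8 q ^ 2 = (8 * G8 (q ^ 2) + 32 * G8 (q ^ 2) ^ 2) * G8 q
        + (G8 (q ^ 2) + 4 * G8 (q ^ 2) ^ 2)) ∧
    (∀ τ : UpperHalfPlane,
      (ModularForm.eta (4 * (τ : ℂ)) / ModularForm.eta (τ : ℂ)) ^ 8 =
        G8 (Complex.exp (2 * Real.pi * Complex.I * (τ : ℂ)))
          + 4 * G8 (Complex.exp (2 * Real.pi * Complex.I * (τ : ℂ))) ^ 2) := by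
  refine ⟨fun q hq => G8_sq_eq hq, fun τ => ?_⟩
  rw [eta_four_mul_div_eta_pow, G8_add_four_mul_sq (Complex.exp_ne_zero _)
    (UpperHalfPlane.norm_exp_two_pi_I_lt_one τ)]
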